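/- Let $n\ge 1$ and let $\tau=(x_1,\dots,x_n)$ be a finite real time series. The \emph{horizon visibility graph} $\mathrm{HVG}_\infty(\tau)$ has vertices $0,1,\dots,n+1$. With $x_0=x_{n+1}=\infty$, vertices $i<j$ are adjacent iff $x_k<x_i$ and $x_k<x_j$ for all $i<k<j$. The \emph{time series merge tree} $T_{\check\tau}$ is the merge tree of the path $0-1-\cdots-n$ in which the edge joining $i-1$ and $i$ has weight $x_i$. Its vertices are the vertex sets of the connected components of the subgraphs $\check\tau_a$ ($a\in\mathbb R$) formed by all vertices and the edges of weight at most $a$. They are ordered by inclusion; the root is $\{0,\dots,n\}$ and the leaves are $\{0\},\dots,\{n\}$. As usual, a root edge ending in a further vertex $\infty$ is attached above the root. A plane rooted tree with leaves $0,\dots,n$ in this order, in which no vertex has exactly one child, is drawn in the closed disk with $\infty,0,1,\dots,n$ placed in this circular order on the boundary circle. Its \emph{dual} has as vertices the $n+2$ regions of the disk, where region $k$ is the one at the boundary arc between $k-1$ and $k$ (with $-1$ and $n+1$ both read as $\infty$), and two regions are adjacent iff they share an edge of the tree. The \emph{first Horton pruning} of a rooted tree is obtained by removing all leaves together with the edges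 above them and then suppressing all vertices of degree two (the root edge counts towards the degree of the root). Let $\mathrm{PL}_\tau:\mathbb R\to\mathbb R$ be the piecewise linear interpolation: $\mathrm{PL}_\tau(k)=x_k$ for $1\le k\le n$, affine on each $[k,k+1]$ with $1\le k<n$, and constant on $(-\infty,1]$ and on $[n,\infty)$. The points of its merge tree are the pairs $(C,\lambda)$ with $C$ a connected component of $\{t:\mathrm{PL}_\tau(t)\le\lambda\}$, where $(C,\lambda)\le(C',\lambda')$ iff $\lambda\le\lambda'$ and $C\subseteq C'$. Its \emph{branch structure} is the rooted tree whose vertices are the minimal points (births of components) and the least upper bounds of two incomparable points (mergers), with the induced order. \textbf{Proposition.} $T_{\check\tau}$ is the unique plane tree of the above kind whose dual is $\mathrm{HVG}_\infty(\tau)$, and the first Horton pruning of this tree is isomorphic, as a rooted tree and with the left-to-right order of branches preserved, to the branch structure of the merge tree of $\mathrm{PL}_\tau$. -/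

import Mathlib

noncomputable section

/-! ### Horizon visibility graphs -/

/-- The horizontal visibility graph of a finite series with values in a linear order:
`i` and `j` are adjacent iff every value strictly between them lies strictly below both. -/
def horizontalVisibilityGraph {m : ℕ} {α : Type*} [LinearOrder α] (x : Fin m → α) :
    SimpleGraph (Fin m) where
  Adj i j := i ≠ j ∧ ∀ k, min i j < k → k < max i j → x k < x i ∧ x k < x j
  symm := ⟨fun i j h => ⟨h.1.symm, fun k h₁ h₂ =>
    (h.2 k (by rwa [min_comm]) (by rwa [max_comm])).symm⟩⟩
  loopless := ⟨fun _ h => h.1 rfl⟩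

/-- The series `(∞, x₁, …, xₙ, ∞)`. -/
def horizonExtension {n : ℕ} (τ : Fin n → ℝ) : Fin (n + 2) → WithTop ℝ :=
  Fin.cons (α := fun _ => WithTop ℝ) ⊤
    (Fin.snoc (α := fun _ => WithTop ℝ) (fun i => (τ i : WithTop ℝ)) ⊤)

/-- The horizon visibility graph of a time series. -/
def horizonVisibilityGraph {n : ℕ} (τ : Fin n → ℝ) : SimpleGraph (Fin (n + 2)) :=
  horizontalVisibilityGraph (horizonExtension τ)

/-! ### Merge trees of weighted graphs and of time series -/

/-- The sublevel graph: all vertices, and the edges of weight at most `a`. -/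
def sublevelGraph {V : Type*} (G : SimpleGraph V) (w : Sym2 V → ℝ) (a : ℝ) : SimpleGraph V where
  Adj u v := G.Adj u v ∧ w s(u, v) ≤ a
  symm := ⟨fun u v h => ⟨h.1.symm, by rw [Sym2.eq_swap]; exact h.2⟩⟩
  loopless := ⟨fun u h => G.loopless.irrefl u h.1⟩

/-- The merge tree of a weighted graph: its vertices are the vertex sets of the connected
components of the sublevel graphs, and a vertex `C` is a descendant of `D` iff `C ⊆ D`. -/
def graphMergeTree {V : Type*} (G : SimpleGraph V) (w : Sym2 V → ℝ) : Set (Set V) :=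
  {C | ∃ a : ℝ, ∃ c : (sublevelGraph G w a).ConnectedComponent, C = c.supp}

/-- The weights of the path `0 - 1 - ⋯ - n`: the edge joining `i` and `i + 1` carries the
entry `τ i` (the value at pairs that are not edges of the path plays no role). -/
def pathWeight {n : ℕ} (τ : Fin n → ℝ) (e : Sym2 (Fin (n + 1))) : ℝ :=
  if h : (e.inf : ℕ) < n then τ ⟨e.inf, h⟩ else 0

/-- The merge tree of a time series: the merge tree of its weighted path. -/
def timeSeriesMergeTree {n : ℕ} (τ : Fin n → ℝ) : Set (Set (Fin (n + 1))) :=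
  graphMergeTree (SimpleGraph.pathGraph (n + 1)) (pathWeight τ)

/-! ### Plane trees and their duals -/

/-- A plane rooted tree with leaves `0, 1, …, n` in this order and without vertices having exactly
one child, encoded by the leaf sets of its principal subtrees: each vertex is identified
with the set of leaves descended from it, and also with the edge above it (the root edge, for
the root). -/
structure IsPlaneTree {n : ℕ} (T : Set (Set (Fin (n + 1)))) : Prop where
  root_mem : Set.univ ∈ T
  leaf_mem : ∀ i, {i} ∈ T
  nonempty : ∀ C ∈ T, C.Nonempty
  laminar : ∀ C ∈ T, ∀ D ∈ T, C ⊆ D ∨ D ⊆ C ∨ Disjoint C D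
  ordConnected : ∀ C ∈ T, C.OrdConnected

/-- The tree is drawn in the closed disk with the leaves `0, …, n` and the upper end `∞` of the
root edge on the circle, in the circular order `∞, 0, 1, …, n`. The region numbered `k` is the one
at the arc between the consecutive external vertices `k - 1` and `k` (where `-1` and `n + 1`
both mean `∞`); apart from this arc its boundary is the tree path between these two vertices.
So the edge above the vertex `C` bounds the region iff it separates them, that is, iff
exactly one of them is in `C`. -/
def BoundsRegion {n : ℕ} (C : Set (Fin (n + 1))) (k : Fin (n + 2)) : Prop :=
  Xor (∃ i ∈ C, i.succ = k) (∃ i ∈ C, i.castSucc = k)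

/-- The dual of a plane tree in the disk: two regions are adjacent iff they share an edge of
the tree. -/
def dualGraph {n : ℕ} (T : Set (Set (Fin (n + 1)))) : SimpleGraph (Fin (n + 2)) where
  Adj i j := i ≠ j ∧ ∃ C ∈ T, BoundsRegion C i ∧ BoundsRegion C j
  symm := ⟨fun _ _ h => ⟨h.1.symm, h.2.imp fun _ hC => ⟨hC.1, hC.2.symm⟩⟩⟩
  loopless := ⟨fun _ h => h.1 rfl⟩

/-! ### Horton pruning -/

/-- What remains of a finite rooted tree (ordered by descent, root at the top, leaves minimal)
when all leaves and the edges above them are cut off. -/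
abbrev CutLeaves (P : Type*) [PartialOrder P] : Type _ := {v : P // ¬ IsMin v}

/-- Suppression of the degree-two vertices of a rooted tree. Every vertex, the root included,
has one edge above it, so the vertices of degree two are those with exactly one child. -/
abbrev ContractChains (P : Type*) [PartialOrder P] : Type _ := {v : P // ¬ ∃! c, c ⋖ v}

/-- A single Horton pruning of a rooted tree. -/
abbrev HortonPruning (P : Type*) [PartialOrder P] : Type _ := ContractChains (CutLeaves P)

/-! ### Merge trees of functions -/

/-- A point of the merge tree of `f`: a connected component of a sublevel set of `f`, together
with its level. -/
@[ext]
structure MergePoint {X : Type*} [TopologicalSpace X] (f : X → ℝ) where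
  carrier : Set X
  level : ℝ
  isComponent : ∃ x, f x ≤ level ∧ carrier = connectedComponentIn {y | f y ≤ level} x

instance {X : Type*} [TopologicalSpace X] (f : X → ℝ) : PartialOrder (MergePoint f) where
  le p q := p.level ≤ q.level ∧ p.carrier ⊆ q.carrier
  le_refl p := ⟨le_refl _, subset_rfl⟩
  le_trans _ _ _ h₁ h₂ := ⟨h₁.1.trans h₂.1, h₁.2.trans h₂.2⟩
  le_antisymm _ _ h₁ h₂ :=
    MergePoint.ext (Set.Subset.antisymm h₁.2 h₂.2) (le_antisymm h₁.1 h₂.1)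

/-- The branch structure of the merge tree of `f`: the vertices are the points at which a
component is born (the minimal points) and those at which two different branches merge
(the least common ancestors of two incomparable points), ordered by descent. -/
abbrev MergeVertex {X : Type*} [TopologicalSpace X] (f : X → ℝ) : Type _ :=
  {p : MergePoint f // IsMin p ∨ ∃ q r : MergePoint f, ¬ q ≤ r ∧ ¬ r ≤ q ∧ IsLUB {q, r} p}

/-! ### Piecewise linear interpolation -/

/-- The entry with (one-based) index `k`; indices below `1` give the first and
indices above `n` the last entry. -/
def clampedEntry {n : ℕ} [NeZero n] (τ : Fin n → ℝ) (k : ℤ) : ℝ :=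
  τ ⟨min (k - 1).toNat (n - 1), by have := NeZero.pos n; omega⟩

/-- The piecewise linear interpolation of `τ = (x₁, …, xₙ)`: it takes the value `xₖ` at
`k = 1, …, n`, is affine on each `[k, k + 1]`, and is constant on `(-∞, 1]` and on `[n, ∞)`. -/
def plInterpolation {n : ℕ} [NeZero n] (τ : Fin n → ℝ) (t : ℝ) : ℝ :=
  (1 - Int.fract t) * clampedEntry τ ⌊t⌋ + Int.fract t * clampedEntry τ (⌊t⌋ + 1)

/-! ### Left-to-right order -/

/-- `A` lies entirely to the left of `B`. -/
def LeftOf {α : Type*} [LT α] (A B : Set α) : Prop := ∀ a ∈ A, ∀ b ∈ B, a < b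

end

/-!
Deleting the edges of weight greater than `a` cuts the path `0 - 1 - ⋯ - n` into intervals. So
`[i, j]` is a vertex of the merge tree iff some `a` is at least every entry between `i` and `j` and
smaller than the two adjacent entries (`∞` at the ends of the path). Such an `a` exists iff all
entries in between are smaller than the two adjacent ones, which says that `i` and `j + 1` are
adjacent in the horizon visibility graph. On the other hand, the edge above the vertex `[i, j]`
bounds the regions `i` and `j + 1` and no others, so the dual of a plane tree records exactly which
intervals are vertices of the tree.

For the branch structure, send a vertex `C` that is not a leaf to the point of the merge tree of the
interpolation at which the largest entry inside `C` first appears, and send a point of that merge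
tree to the interval spanned by the entries sampled in its component. Since the interpolation is
monotone between consecutive samples, a component is governed by its samples, and the two maps form
a Galois coinsertion. The lower adjoint of a Galois coinsertion into a forest preserves and reflects
minimal points and least upper bounds of incomparable pairs, and its image contains all of these.
Finally, in a finite forest these points are precisely the vertices without exactly one child.
-/

section Forest

variable {P M : Type*} [PartialOrder P] [PartialOrder M] {l : P → M} {u : M → P}

/-- An ordered set is a forest, growing downwards from its roots, if the points above any given
point form a chain. -/
def IsForestOrder (M : Type*) [PartialOrder M] : Prop :=
  ∀ ⦃p q r : M⦄, p ≤ q → p ≤ r → q ≤ r ∨ r ≤ q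

/-- A point of an ordered set is a branch point if it is minimal or the least upper bound of two
incomparable points: in a merge tree, a birth or a merger. -/
def IsBranchPoint (p : M) : Prop :=
  IsMin p ∨ ∃ q r : M, ¬ q ≤ r ∧ ¬ r ≤ q ∧ IsLUB {q, r} p

namespace IsForestOrder

theorem isLUB_of_covBy (hP : IsForestOrder P) {a b c : P} (ha : a ⋖ c) (hb : b ⋖ c)
    (hab : a ≠ b) : IsLUB {a, b} c := by
  refine ⟨by simp [ha.le, hb.le], fun d hd => ?_⟩
  have had : a ≤ d := hd (by simp)
  have hbd : b ≤ d := hd (by simp)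
  refine (hP had ha.le).elim (fun hdc => ?_) id
  by_contra hcd
  have hdc' : d < c := lt_of_le_not_ge hdc hcd
  exact hab ((had.eq_of_not_lt fun h => ha.2 h hdc').trans
    (hbd.eq_of_not_lt fun h => hb.2 h hdc').symm)

theorem isBranchPoint_iff [Finite P] (hP : IsForestOrder P) {c : P} :
    IsBranchPoint c ↔ ¬ ∃! d, d ⋖ c := by
  constructor
  · rintro (hmin | ⟨q, r, hqr, hrq, hc⟩) ⟨d, hd, hunique⟩
    · exact hmin.not_lt hd.lt
    · have hq : q < c := (hc.1 (by simp)).lt_of_not_ge fun h => hrq ((hc.1 (by simp)).trans h)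
      have hr : r < c := (hc.1 (by simp)).lt_of_not_ge fun h => hqr ((hc.1 (by simp)).trans h)
      obtain ⟨a, hqa, ha⟩ := exists_le_covBy_of_lt hq
      obtain ⟨b, hrb, hb⟩ := exists_le_covBy_of_lt hr
      obtain rfl := hunique a ha
      obtain rfl := hunique b hb
      exact hd.lt.not_ge (hc.2 (by simp [hqa, hrb]))
  · intro hc
    refine or_iff_not_imp_left.2 fun hmin => ?_
    obtain ⟨x, hx⟩ := not_isMin_iff.1 hmin
    obtain ⟨a, -, ha⟩ := exists_le_covBy_of_lt hx
    obtain ⟨b, hb, hba⟩ : ∃ b, b ⋖ c ∧ b ≠ a := by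
      by_contra! h
      exact hc ⟨a, ha, h⟩
    exact ⟨a, b, fun h => ha.2 (h.lt_of_ne hba.symm) hb.lt, fun h => hb.2 (h.lt_of_ne hba) ha.lt,
      hP.isLUB_of_covBy ha hb hba.symm⟩

theorem of_galoisCoinsertion (hM : IsForestOrder M) (gi : GaloisCoinsertion l u) :
    IsForestOrder P := fun _ _ _ hq hr => by
  simpa only [gi.l_le_l_iff] using hM (gi.gc.monotone_l hq) (gi.gc.monotone_l hr)

theorem le_l_of_u_le (hM : IsForestOrder M) (gc : GaloisConnection l u) {q r : M} {d : P}
    (hqr : ¬ q ≤ r) (hrq : ¬ r ≤ q) (hq : u q ≤ d) (hr : u r ≤ d) : q ≤ l d := by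
  refine (hM (gc.l_u_le q) (gc.monotone_l hq)).elim id fun hdq => ?_
  have hrq' : l (u r) ≤ q := (gc.monotone_l hr).trans hdq
  exact absurd (hM hrq' (gc.l_u_le r)) (by tauto)

theorem isLUB_u_of_isLUB_l (hM : IsForestOrder M) (gi : GaloisCoinsertion l u) {q r : M} {c : P}
    (hqr : ¬ q ≤ r) (hrq : ¬ r ≤ q) (h : IsLUB {q, r} (l c)) : IsLUB {u q, u r} c := by
  have u_le {s : M} (hs : s ≤ l c) : u s ≤ c := (gi.gc.monotone_u hs).trans_eq (gi.u_l_eq c)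
  refine ⟨?_, fun d hd => gi.l_le_l_iff.1 (h.2 ?_)⟩
  · simp [u_le (h.1 (Set.mem_insert q {r})), u_le (h.1 (Set.mem_insert_of_mem q rfl))]
  · have hq : u q ≤ d := hd (by simp)
    have hr : u r ≤ d := hd (by simp)
    simp [hM.le_l_of_u_le gi.gc hqr hrq hq hr, hM.le_l_of_u_le gi.gc hrq hqr hr hq]

theorem not_u_le_u (hM : IsForestOrder M) (gc : GaloisConnection l u) {q r : M}
    (hqr : ¬ q ≤ r) (hrq : ¬ r ≤ q) : ¬ u q ≤ u r := fun h =>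
  (hM (gc.l_u_le q) (gc.l_le h)).elim hqr hrq

theorem isBranchPoint_l_iff (hM : IsForestOrder M) (gi : GaloisCoinsertion l u) {c : P} :
    IsBranchPoint (l c) ↔ IsBranchPoint c := by
  constructor
  · rintro (hmin | ⟨q, r, hqr, hrq, h⟩)
    · exact Or.inl fun d hd => gi.l_le_l_iff.1 (hmin (gi.gc.monotone_l hd))
    · exact Or.inr ⟨u q, u r, hM.not_u_le_u gi.gc hqr hrq, hM.not_u_le_u gi.gc hrq hqr,
        hM.isLUB_u_of_isLUB_l gi hqr hrq h⟩
  · rintro (hmin | ⟨a, b, hab, hba, h⟩)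
    · refine Or.inl fun q hq => gi.gc.l_le (hmin ?_)
      exact (gi.gc.monotone_u hq).trans_eq (gi.u_l_eq c)
    · refine Or.inr ⟨l a, l b, by rwa [gi.l_le_l_iff], by rwa [gi.l_le_l_iff], ?_⟩
      simpa only [Set.image_pair] using gi.gc.isLUB_l_image h

theorem l_u_eq_of_isBranchPoint (hM : IsForestOrder M) (gc : GaloisConnection l u) {p : M}
    (hp : IsBranchPoint p) : l (u p) = p := by
  refine le_antisymm (gc.l_u_le p) ?_
  rcases hp with hmin | ⟨q, r, hqr, hrq, h⟩
  · exact hmin (gc.l_u_le p)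
  · have hq : u q ≤ u p := gc.monotone_u (h.1 (by simp))
    have hr : u r ≤ u p := gc.monotone_u (h.1 (by simp))
    exact h.2 (by simp [hM.le_l_of_u_le gc hqr hrq hq hr, hM.le_l_of_u_le gc hrq hqr hr hq])

/-- Contracting the chains of a finite coreflective suborder `P` of a forest `M` leaves exactly
the branch points of `M`. -/
def contractChainsOrderIso [Finite P] (hM : IsForestOrder M) (gi : GaloisCoinsertion l u) :
    ContractChains P ≃o {p : M // IsBranchPoint p} where
  toFun c := ⟨l c, (hM.isBranchPoint_l_iff gi).2
    ((hM.of_galoisCoinsertion gi).isBranchPoint_iff.2 c.2)⟩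
  invFun p := ⟨u p, (hM.of_galoisCoinsertion gi).isBranchPoint_iff.1
    ((hM.isBranchPoint_l_iff gi).1 ((hM.l_u_eq_of_isBranchPoint gi.gc p.2).symm ▸ p.2))⟩
  left_inv c := Subtype.ext (gi.u_l_eq c)
  right_inv p := Subtype.ext (hM.l_u_eq_of_isBranchPoint gi.gc p.2)
  map_rel_iff' := gi.l_le_l_iff

end IsForestOrder

end Forest

section GraphMergeTree

variable {V : Type*} {G : SimpleGraph V} {w : Sym2 V → ℝ} {a b : ℝ} {C D : Set V}

theorem sublevelGraph_mono (hab : a ≤ b) : sublevelGraph G w a ≤ sublevelGraph G w b :=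
  fun _ _ h => ⟨h.1, h.2.trans hab⟩

theorem sublevelGraph_eq_self (ha : ∀ e, w e ≤ a) : sublevelGraph G w a = G := by
  ext u v
  exact and_iff_left (ha _)

theorem sublevelGraph_eq_bot (ha : ∀ e, a < w e) : sublevelGraph G w a = ⊥ := by
  ext u v
  simp [sublevelGraph, ha]

theorem mem_graphMergeTree_iff :
    C ∈ graphMergeTree G w ↔ ∃ a v, C = {x | (sublevelGraph G w a).Reachable v x} := by
  have supp_eq (a : ℝ) (v : V) : ((sublevelGraph G w a).connectedComponentMk v).supp =
      {x | (sublevelGraph G w a).Reachable v x} := by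
    ext x
    rw [SimpleGraph.ConnectedComponent.mem_supp_iff, SimpleGraph.ConnectedComponent.eq,
      SimpleGraph.reachable_comm, Set.mem_ofPred_eq]
  constructor
  · rintro ⟨a, ⟨v⟩, rfl⟩
    exact ⟨a, v, supp_eq a v⟩
  · rintro ⟨a, v, rfl⟩
    exact ⟨a, _, (supp_eq a v).symm⟩

theorem nonempty_of_mem_graphMergeTree (hC : C ∈ graphMergeTree G w) : C.Nonempty := by
  obtain ⟨a, c, rfl⟩ := hC
  exact c.nonempty_supp

theorem graphMergeTree_laminar (hC : C ∈ graphMergeTree G w) (hD : D ∈ graphMergeTree G w) :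
    C ⊆ D ∨ D ⊆ C ∨ Disjoint C D := by
  obtain ⟨a, u, rfl⟩ := mem_graphMergeTree_iff.1 hC
  obtain ⟨b, v, rfl⟩ := mem_graphMergeTree_iff.1 hD
  rw [← or_assoc, or_iff_not_imp_right, Set.not_disjoint_iff]
  rintro ⟨x, hux, hvx⟩
  refine (le_total a b).imp (fun hab y huy => ?_) fun hba y hvy => ?_
  · exact hvx.trans ((hux.symm.trans huy).mono (sublevelGraph_mono hab))
  · exact hux.trans ((hvx.symm.trans hvy).mono (sublevelGraph_mono hba))

theorem univ_mem_graphMergeTree [Finite V] (hG : G.Connected) :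
    Set.univ ∈ graphMergeTree G w := by
  obtain ⟨a, ha⟩ := (Set.finite_range w).bddAbove
  have hGa : sublevelGraph G w a = G := sublevelGraph_eq_self fun e => ha ⟨e, rfl⟩
  obtain ⟨v⟩ := hG.nonempty
  refine mem_graphMergeTree_iff.2 ⟨a, v, ?_⟩
  rw [hGa]
  exact (Set.eq_univ_of_forall fun x => hG.preconnected v x).symm

theorem singleton_mem_graphMergeTree [Finite V] (v : V) : {v} ∈ graphMergeTree G w := by
  obtain ⟨b, hb⟩ := (Set.finite_range w).bddBelow
  obtain ⟨a, hab⟩ := exists_lt b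
  have hGa : sublevelGraph G w a = ⊥ :=
    sublevelGraph_eq_bot fun e => hab.trans_le (hb ⟨e, rfl⟩)
  refine mem_graphMergeTree_iff.2 ⟨a, v, ?_⟩
  ext x
  rw [hGa, Set.mem_singleton_iff, Set.mem_ofPred_eq, SimpleGraph.reachable_bot, eq_comm]

end GraphMergeTree

section Edges

variable {n : ℕ} {C : Set (Fin (n + 1))} {E : Set (Fin n)} {i j : Fin (n + 1)} {k l : Fin n}

/-- The edges of the path `0 - 1 - ⋯ - n` with both ends in `C`, where the edge `k` joins the
vertices `k` and `k + 1`. -/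
def innerEdges (C : Set (Fin (n + 1))) : Set (Fin n) :=
  {k | k.castSucc ∈ C ∧ k.succ ∈ C}

/-- The vertices of the path `0 - 1 - ⋯ - n` that are ends of the edges in `E`. -/
def edgeEnds (E : Set (Fin n)) : Set (Fin (n + 1)) :=
  Fin.castSucc '' E ∪ Fin.succ '' E

theorem gc_edgeEnds_innerEdges :
    GaloisConnection (edgeEnds (n := n)) innerEdges := fun E C => by
  change edgeEnds E ⊆ C ↔ E ⊆ innerEdges C
  simp only [edgeEnds, Set.union_subset_iff, Set.image_subset_iff]
  exact Set.subset_inter_iff.symm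

theorem ordConnected_innerEdges (hC : C.OrdConnected) : (innerEdges C).OrdConnected :=
  (hC.preimage_mono Fin.strictMono_castSucc.monotone).inter
    (hC.preimage_mono Fin.strictMono_succ.monotone)

theorem innerEdges_edgeEnds (hE : E.OrdConnected) : innerEdges (edgeEnds E) = E := by
  refine Set.Subset.antisymm ?_ (gc_edgeEnds_innerEdges.le_u_l E)
  rintro k ⟨hk, hk'⟩
  obtain ⟨l, hl, hlk⟩ : ∃ l ∈ E, l ≤ k := by
    rcases hk with ⟨l, hl, h⟩ | ⟨l, hl, h⟩ <;> exact ⟨l, hl, by rw [Fin.ext_iff] at h; grind⟩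
  obtain ⟨m, hm, hkm⟩ : ∃ m ∈ E, k ≤ m := by
    rcases hk' with ⟨m, hm, h⟩ | ⟨m, hm, h⟩ <;> exact ⟨m, hm, by rw [Fin.ext_iff] at h; grind⟩
  exact hE.out hl hm ⟨hlk, hkm⟩

theorem ordConnected_edgeEnds (hE : E.OrdConnected) : (edgeEnds E).OrdConnected := by
  refine Set.ordConnected_iff.2 fun i hi j hj _ m hm => ?_
  obtain ⟨k, hk, hki⟩ : ∃ k ∈ E, k.castSucc ≤ i := by
    rcases hi with ⟨k, hk, h⟩ | ⟨k, hk, h⟩ <;> exact ⟨k, hk, by grind⟩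
  obtain ⟨l, hl, hjl⟩ : ∃ l ∈ E, j ≤ l.succ := by
    rcases hj with ⟨l, hl, h⟩ | ⟨l, hl, h⟩ <;> exact ⟨l, hl, by grind⟩
  have hkm := hki.trans hm.1
  rcases hkm.eq_or_lt with rfl | hlt
  · exact Or.inl ⟨k, hk, rfl⟩
  · obtain ⟨m, rfl⟩ := Fin.exists_succ_eq.2 (Fin.ne_zero_of_lt hlt)
    exact Or.inr ⟨m, hE.out hk hl ⟨Fin.castSucc_lt_succ_iff.1 hlt,
      Fin.succ_le_succ_iff.1 (hm.2.trans hjl)⟩, rfl⟩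

theorem edgeEnds_innerEdges (hC : C.OrdConnected) (hne : C.Nontrivial) :
    edgeEnds (innerEdges C) = C := by
  refine Set.Subset.antisymm (gc_edgeEnds_innerEdges.l_u_le C) fun i hi => ?_
  obtain ⟨j, hj, hji⟩ := hne.exists_ne i
  rcases hji.lt_or_gt with hlt | hgt
  · obtain ⟨k, rfl⟩ := Fin.exists_succ_eq.2 (Fin.ne_zero_of_lt hlt)
    have hk : k.castSucc ∈ C := hC.out hj hi ⟨Fin.le_castSucc_iff.2 hlt, Fin.castSucc_lt_succ.le⟩
    exact Or.inr ⟨k, ⟨hk, hi⟩, rfl⟩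
  · obtain ⟨k, rfl⟩ := Fin.exists_castSucc_eq.2 (Fin.ne_last_of_lt hgt)
    have hk : k.succ ∈ C :=
      hC.out hi hj ⟨Fin.castSucc_lt_succ.le, Fin.castSucc_lt_iff_succ_le.1 hgt⟩
    exact Or.inl ⟨k, ⟨hi, hk⟩, rfl⟩

theorem nonempty_innerEdges (hC : C.OrdConnected) (hne : C.Nontrivial) :
    (innerEdges C).Nonempty := by
  rw [Set.nonempty_iff_ne_empty]
  intro hempty
  have hedge := edgeEnds_innerEdges hC hne
  rw [hempty, edgeEnds, Set.image_empty, Set.image_empty, Set.union_empty] at hedge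
  exact hne.nonempty.ne_empty hedge.symm

theorem mem_innerEdges_Icc : k ∈ innerEdges (Set.Icc i j) ↔ i ≤ k.castSucc ∧ k.succ ≤ j := by
  simp only [innerEdges, Set.mem_Icc, Set.mem_ofPred_eq]
  grind

end Edges

section PathClusters

variable {n : ℕ} {τ : Fin n → ℝ} {a b : ℝ} {C : Set (Fin (n + 1))} {i j : Fin (n + 1)}
  {k : Fin n}

theorem pathWeight_castSucc_succ (τ : Fin n → ℝ) (k : Fin n) :
    pathWeight τ s(k.castSucc, k.succ) = τ k := by
  simp [pathWeight, Fin.castSucc_lt_succ.le]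

theorem pathGraph_adj_iff_exists :
    (SimpleGraph.pathGraph (n + 1)).Adj i j ↔ ∃ k : Fin n, s(k.castSucc, k.succ) = s(i, j) := by
  rw [SimpleGraph.pathGraph_adj]
  simp only [Sym2.eq_iff]
  constructor
  · rintro (h | h)
    · exact ⟨⟨i, by grind⟩, by grind⟩
    · exact ⟨⟨j, by grind⟩, by grind⟩
  · grind

theorem sublevelGraph_path_adj_iff :
    (sublevelGraph (SimpleGraph.pathGraph (n + 1)) (pathWeight τ) a).Adj i j ↔
      ∃ k, τ k ≤ a ∧ s(k.castSucc, k.succ) = s(i, j) := by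
  change _ ∧ _ ↔ _
  rw [pathGraph_adj_iff_exists]
  constructor
  · rintro ⟨⟨k, hk⟩, ha⟩
    exact ⟨k, by rwa [← hk, pathWeight_castSucc_succ] at ha, hk⟩
  · rintro ⟨k, ha, hk⟩
    exact ⟨⟨k, hk⟩, by rwa [← hk, pathWeight_castSucc_succ]⟩

theorem sublevelGraph_path_reachable_iff :
    (sublevelGraph (SimpleGraph.pathGraph (n + 1)) (pathWeight τ) a).Reachable i j ↔
      ∀ k ∈ innerEdges (Set.uIcc i j), τ k ≤ a := by
  constructor
  · rintro ⟨p⟩ k hk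
    by_contra hka
    have same_side : i ≤ k.castSucc ↔ j ≤ k.castSucc := by
      clear hk
      induction p with
      | nil => rfl
      | cons hadj _ ih =>
        obtain ⟨l, hl, hlk⟩ := sublevelGraph_path_adj_iff.1 hadj
        have hne : l ≠ k := by rintro rfl; exact hka hl
        rw [← ih]
        rw [Sym2.eq_iff] at hlk
        grind
    obtain ⟨hk₁, hk₂⟩ := mem_innerEdges_Icc.1 hk
    grind
  · intro h
    rw [SimpleGraph.reachable_iff_reflTransGen]
    have adj_succ {m : Fin (n + 1)} (hm : min i j ≤ m) (hm' : m < max i j) :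
        (sublevelGraph (SimpleGraph.pathGraph (n + 1)) (pathWeight τ) a).Adj m (Order.succ m) := by
      obtain ⟨k, rfl⟩ := Fin.exists_castSucc_eq.2 (Fin.ne_last_of_lt hm')
      rw [Fin.orderSucc_castSucc]
      refine sublevelGraph_path_adj_iff.2 ⟨k, h k (mem_innerEdges_Icc.2 ⟨hm, ?_⟩), rfl⟩
      exact Fin.castSucc_lt_iff_succ_le.1 hm'
    refine reflTransGen_of_succ _ (fun m hm => adj_succ ?_ ?_) fun m hm => (adj_succ ?_ ?_).symm
    all_goals simp [hm.1, hm.2]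

/-- `C` spans a connected component of the path `0 - 1 - ⋯ - n` with the edges of weight at most
`a`: a nonempty interval that contains both or none of the ends of these edges, and both ends of
no other edge. -/
structure IsClusterAt (τ : Fin n → ℝ) (a : ℝ) (C : Set (Fin (n + 1))) : Prop where
  nonempty : C.Nonempty
  ordConnected : C.OrdConnected
  le_of_mem_innerEdges : ∀ k ∈ innerEdges C, τ k ≤ a
  castSucc_mem_iff : ∀ k, τ k ≤ a → (k.castSucc ∈ C ↔ k.succ ∈ C)

theorem isClusterAt_setOf_reachable (τ : Fin n → ℝ) (a : ℝ) (i : Fin (n + 1)) :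
    IsClusterAt τ a
      {j | (sublevelGraph (SimpleGraph.pathGraph (n + 1)) (pathWeight τ) a).Reachable i j} where
  nonempty := ⟨i, SimpleGraph.Reachable.refl i⟩
  ordConnected := by
    refine ⟨fun x hx y hy z hz => hx.trans (sublevelGraph_path_reachable_iff.2 fun k hk => ?_)⟩
    refine sublevelGraph_path_reachable_iff.1 (hx.symm.trans hy) k
      (gc_edgeEnds_innerEdges.monotone_u ?_ hk)
    exact Set.uIcc_subset_uIcc_left (Set.Icc_subset_uIcc hz)
  le_of_mem_innerEdges k hk :=
    sublevelGraph_path_reachable_iff.1 (hk.1.symm.trans hk.2) k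
      ⟨Set.left_mem_uIcc, Set.right_mem_uIcc⟩
  castSucc_mem_iff k hk := by
    have hadj : (sublevelGraph (SimpleGraph.pathGraph (n + 1)) (pathWeight τ) a).Adj
        k.castSucc k.succ := sublevelGraph_path_adj_iff.2 ⟨k, hk, rfl⟩
    exact ⟨fun h => h.trans hadj.reachable, fun h => h.trans hadj.symm.reachable⟩

namespace IsClusterAt

theorem eq_setOf_reachable (hC : IsClusterAt τ a C) (hi : i ∈ C) :
    C = {j | (sublevelGraph (SimpleGraph.pathGraph (n + 1)) (pathWeight τ) a).Reachable i j} := by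
  ext j
  constructor
  · intro hj
    exact sublevelGraph_path_reachable_iff.2 fun k hk => hC.le_of_mem_innerEdges k
      (gc_edgeEnds_innerEdges.monotone_u (hC.ordConnected.uIcc_subset hi hj) hk)
  · rintro ⟨p⟩
    induction p with
    | nil => exact hi
    | cons hadj _ ih =>
      obtain ⟨k, hk, hkij⟩ := sublevelGraph_path_adj_iff.1 hadj
      rcases Sym2.eq_iff.1 hkij with ⟨rfl, rfl⟩ | ⟨rfl, rfl⟩
      · exact ih ((hC.castSucc_mem_iff k hk).1 hi)
      · exact ih ((hC.castSucc_mem_iff k hk).2 hi)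

theorem of_le (hC : IsClusterAt τ a C) (hba : b ≤ a) (hb : ∀ k ∈ innerEdges C, τ k ≤ b) :
    IsClusterAt τ b C where
  nonempty := hC.nonempty
  ordConnected := hC.ordConnected
  le_of_mem_innerEdges := hb
  castSucc_mem_iff k hk := hC.castSucc_mem_iff k (hk.trans hba)

theorem innerEdges_eq_ordConnectedComponent (hC : IsClusterAt τ a C) (hk : k ∈ innerEdges C) :
    innerEdges C = Set.ordConnectedComponent {l | τ l ≤ a} k := by
  have := ordConnected_innerEdges hC.ordConnected
  refine Set.Subset.antisymm
    (Set.subset_ordConnectedComponent hk hC.le_of_mem_innerEdges) fun l hl => ?_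
  have castSucc_mem : l.castSucc ∈ C := by
    rw [hC.eq_setOf_reachable hk.1]
    refine sublevelGraph_path_reachable_iff.2 fun m hm => ?_
    obtain ⟨hm₁, hm₂⟩ := mem_innerEdges_Icc.1 hm
    have hm' : m ∈ Set.uIcc k l := ⟨by grind, by grind⟩
    exact hl hm'
  exact ⟨castSucc_mem, (hC.castSucc_mem_iff l (hl Set.right_mem_uIcc)).1 castSucc_mem⟩

end IsClusterAt

theorem isClusterAt_edgeEnds_ordConnectedComponent (hk : τ k ≤ a) :
    IsClusterAt τ a (edgeEnds (Set.ordConnectedComponent {l | τ l ≤ a} k)) where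
  nonempty := ⟨k.castSucc, Or.inl ⟨k, Set.self_mem_ordConnectedComponent.2 hk, rfl⟩⟩
  ordConnected := ordConnected_edgeEnds inferInstance
  le_of_mem_innerEdges l hl := by
    rw [innerEdges_edgeEnds inferInstance] at hl
    have hla : l ∈ {l | τ l ≤ a} := Set.ordConnectedComponent_subset hl
    exact hla
  castSucc_mem_iff l hl := by
    set E := Set.ordConnectedComponent {l | τ l ≤ a} k
    have mem_of_uIcc {m : Fin n} (hm : m ∈ E) (hml : Set.uIcc m l ⊆ {m, l}) : l ∈ E :=
      Set.mem_ordConnectedComponent_trans hm <| hml.trans <|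
        Set.pair_subset (Set.ordConnectedComponent_subset hm) hl
    constructor
    · rintro (⟨m, hm, h⟩ | ⟨m, hm, h⟩)
      · exact Or.inr ⟨l, Fin.castSucc_injective _ h ▸ hm, rfl⟩
      · refine Or.inr ⟨l, mem_of_uIcc hm ?_, rfl⟩
        intro x hx
        rw [Fin.ext_iff] at h
        simp only [Set.mem_uIcc, Set.mem_insert_iff, Set.mem_singleton_iff] at hx ⊢
        grind
    · rintro (⟨m, hm, h⟩ | ⟨m, hm, h⟩)
      · refine Or.inl ⟨l, mem_of_uIcc hm ?_, rfl⟩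
        intro x hx
        rw [Fin.ext_iff] at h
        simp only [Set.mem_uIcc, Set.mem_insert_iff, Set.mem_singleton_iff] at hx ⊢
        grind
      · exact Or.inl ⟨l, Fin.succ_injective _ h ▸ hm, rfl⟩

theorem mem_timeSeriesMergeTree_iff :
    C ∈ timeSeriesMergeTree τ ↔ ∃ a, IsClusterAt τ a C := by
  rw [timeSeriesMergeTree, mem_graphMergeTree_iff]
  constructor
  · rintro ⟨a, i, rfl⟩
    exact ⟨a, isClusterAt_setOf_reachable τ a i⟩
  · rintro ⟨a, hC⟩
    obtain ⟨i, hi⟩ := hC.nonempty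
    exact ⟨a, i, hC.eq_setOf_reachable hi⟩

theorem isPlaneTree_timeSeriesMergeTree (τ : Fin n → ℝ) :
    IsPlaneTree (timeSeriesMergeTree τ) where
  root_mem := univ_mem_graphMergeTree (SimpleGraph.pathGraph_connected n)
  leaf_mem := singleton_mem_graphMergeTree
  nonempty _ := nonempty_of_mem_graphMergeTree
  laminar _ hC _ := graphMergeTree_laminar hC
  ordConnected _ hC := (mem_timeSeriesMergeTree_iff.1 hC).elim fun _ hC => hC.ordConnected

end PathClusters

section Dual

variable {n : ℕ} {T : Set (Set (Fin (n + 1)))} {C : Set (Fin (n + 1))} {i j : Fin (n + 1)}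

theorem exists_eq_Icc_of_ordConnected (hC : C.OrdConnected) (hne : C.Nonempty) :
    ∃ i j, i ≤ j ∧ C = Set.Icc i j := by
  have hIcc : C = Set.Icc (sInf C) (sSup C) := hne.ordConnected_iff_of_bdd'.1 hC
  exact ⟨sInf C, sSup C, Set.nonempty_Icc.1 (hIcc ▸ hne), hIcc⟩

/-- A family of nonempty intervals of `{0, …, n}`: the part of the definition of a plane tree that
makes it recoverable from its dual. -/
def IsIntervalFamily (T : Set (Set (Fin (n + 1)))) : Prop :=
  ∀ C ∈ T, C.Nonempty ∧ C.OrdConnected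

theorem IsPlaneTree.isIntervalFamily (hT : IsPlaneTree T) : IsIntervalFamily T :=
  fun C hC => ⟨hT.nonempty C hC, hT.ordConnected C hC⟩

theorem boundsRegion_Icc_iff {r : Fin (n + 2)} (hij : i ≤ j) :
    BoundsRegion (Set.Icc i j) r ↔ r = i.castSucc ∨ r = j.succ := by
  have castSucc_mem : (∃ m ∈ Set.Icc i j, m.castSucc = r) ↔ i.castSucc ≤ r ∧ r ≤ j.castSucc := by
    constructor
    · rintro ⟨m, hm, rfl⟩
      exact hm
    · rintro ⟨hi, hj⟩
      obtain ⟨m, rfl⟩ := Fin.exists_castSucc_eq.2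
        (hj.trans_lt j.castSucc_lt_last).ne
      exact ⟨m, ⟨hi, hj⟩, rfl⟩
  have succ_mem : (∃ m ∈ Set.Icc i j, m.succ = r) ↔ i.succ ≤ r ∧ r ≤ j.succ := by
    constructor
    · rintro ⟨m, hm, rfl⟩
      exact ⟨Fin.succ_le_succ_iff.2 hm.1, Fin.succ_le_succ_iff.2 hm.2⟩
    · rintro ⟨hi, hj⟩
      obtain ⟨m, rfl⟩ := Fin.exists_succ_eq.2 (i.succ_pos.trans_le hi).ne'
      exact ⟨m, ⟨Fin.succ_le_succ_iff.1 hi, Fin.succ_le_succ_iff.1 hj⟩, rfl⟩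
  rw [BoundsRegion, castSucc_mem, succ_mem, xor_iff_or_and_not_and]
  grind

theorem dualGraph_adj_iff (hT : IsIntervalFamily T) (hij : i ≤ j) :
    (dualGraph T).Adj i.castSucc j.succ ↔ Set.Icc i j ∈ T := by
  constructor
  · rintro ⟨hne, C, hC, hCi, hCj⟩
    obtain ⟨a, b, hab, rfl⟩ := exists_eq_Icc_of_ordConnected (hT C hC).2 (hT C hC).1
    rw [boundsRegion_Icc_iff hab] at hCi hCj
    have : a = i ∧ b = j := by simp only [Fin.ext_iff] at *; grind
    simpa only [this] using hC
  · intro h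
    exact ⟨((Fin.castSucc_le_castSucc_iff.2 hij).trans_lt Fin.castSucc_lt_succ).ne, _, h,
      (boundsRegion_Icc_iff hij).2 (Or.inl rfl), (boundsRegion_Icc_iff hij).2 (Or.inr rfl)⟩

theorem simpleGraph_ext_castSucc_succ {G H : SimpleGraph (Fin (n + 2))}
    (h : ∀ i j : Fin (n + 1), i ≤ j → (G.Adj i.castSucc j.succ ↔ H.Adj i.castSucc j.succ)) :
    G = H := by
  have adj_iff_of_lt {r s : Fin (n + 2)} (hrs : r < s) : G.Adj r s ↔ H.Adj r s := by
    obtain ⟨i, rfl⟩ := Fin.exists_castSucc_eq.2 (Fin.ne_last_of_lt hrs)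
    obtain ⟨j, rfl⟩ := Fin.exists_succ_eq.2 (Fin.ne_zero_of_lt hrs)
    exact h i j (Fin.castSucc_lt_succ_iff.1 hrs)
  ext r s
  rcases lt_trichotomy r s with hrs | rfl | hsr
  · exact adj_iff_of_lt hrs
  · simp
  · rw [G.adj_comm, H.adj_comm, adj_iff_of_lt hsr]

theorem dualGraph_injOn :
    Set.InjOn (dualGraph (n := n)) {T | IsIntervalFamily T} := by
  have subset_of_dualGraph_eq {T U : Set (Set (Fin (n + 1)))}
      (hT : IsIntervalFamily T) (hU : IsIntervalFamily U)
      (h : dualGraph T = dualGraph U) : T ⊆ U := fun C hC => by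
    obtain ⟨i, j, hij, rfl⟩ := exists_eq_Icc_of_ordConnected (hT C hC).2 (hT C hC).1
    rwa [← dualGraph_adj_iff hU hij, ← h, dualGraph_adj_iff hT hij]
  exact fun T hT U hU h => Set.Subset.antisymm (subset_of_dualGraph_eq hT hU h)
    (subset_of_dualGraph_eq hU hT h.symm)

end Dual

section Visibility

variable {n : ℕ} {τ : Fin n → ℝ} {a : ℝ} {i j : Fin (n + 1)}

theorem horizonExtension_succ_castSucc (τ : Fin n → ℝ) (k : Fin n) :
    horizonExtension τ k.castSucc.succ = τ k := by
  simp [horizonExtension]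

theorem lt_horizonExtension_castSucc_iff :
    (a : WithTop ℝ) < horizonExtension τ i.castSucc ↔ ∀ k : Fin n, k.succ = i → a < τ k := by
  cases i using Fin.cases with
  | zero => simp [horizonExtension, Fin.succ_ne_zero]
  | succ k =>
    simp only [← Fin.succ_castSucc, horizonExtension_succ_castSucc, WithTop.coe_lt_coe,
      Fin.succ_inj, forall_eq]

theorem lt_horizonExtension_succ_iff :
    (a : WithTop ℝ) < horizonExtension τ j.succ ↔ ∀ k : Fin n, k.castSucc = j → a < τ k := by
  cases j using Fin.lastCases with
  | last => simp [horizonExtension, Fin.castSucc_ne_last, Fin.succ_last]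
  | cast k =>
    simp only [horizonExtension_succ_castSucc, WithTop.coe_lt_coe, Fin.castSucc_inj, forall_eq]

theorem horizonVisibilityGraph_adj_iff (hij : i ≤ j) :
    (horizonVisibilityGraph τ).Adj i.castSucc j.succ ↔ ∀ k ∈ innerEdges (Set.Icc i j),
      (τ k : WithTop ℝ) < min (horizonExtension τ i.castSucc) (horizonExtension τ j.succ) := by
  have hlt : i.castSucc < j.succ := Fin.castSucc_lt_succ_iff.2 hij
  change _ ∧ _ ↔ _
  simp only [min_eq_left hlt.le, max_eq_right hlt.le, hlt.ne, ne_eq, not_false_eq_true, true_and,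
    mem_innerEdges_Icc, lt_min_iff]
  constructor
  · rintro h k ⟨hik, hkj⟩
    simpa only [horizonExtension_succ_castSucc] using h k.castSucc.succ (by grind) (by grind)
  · intro h r hir hrj
    obtain ⟨m, rfl⟩ := Fin.exists_succ_eq.2 (Fin.ne_zero_of_lt hir)
    obtain ⟨k, rfl⟩ := Fin.exists_castSucc_eq.2 (Fin.ne_last_of_lt (Fin.succ_lt_succ_iff.1 hrj))
    rw [horizonExtension_succ_castSucc]
    exact h k ⟨by grind, by grind⟩

theorem isClusterAt_Icc_iff (hij : i ≤ j) :
    IsClusterAt τ a (Set.Icc i j) ↔ (∀ k ∈ innerEdges (Set.Icc i j), τ k ≤ a) ∧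
      (a : WithTop ℝ) < min (horizonExtension τ i.castSucc) (horizonExtension τ j.succ) := by
  rw [lt_min_iff, lt_horizonExtension_castSucc_iff, lt_horizonExtension_succ_iff]
  constructor
  · refine fun h => ⟨h.le_of_mem_innerEdges, ?_, ?_⟩
    · rintro k rfl
      by_contra! hk
      have := (h.castSucc_mem_iff k hk).2 ⟨le_rfl, hij⟩
      exact this.1.not_gt Fin.castSucc_lt_succ
    · rintro k rfl
      by_contra! hk
      have := (h.castSucc_mem_iff k hk).1 ⟨hij, le_rfl⟩
      exact this.2.not_gt Fin.castSucc_lt_succ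
  · rintro ⟨hle, hi, hj⟩
    refine ⟨Set.nonempty_Icc.2 hij, Set.ordConnected_Icc, hle, fun k hk => ?_⟩
    have hki : k.succ ≠ i := fun h => (hi k h).not_ge hk
    have hkj : k.castSucc ≠ j := fun h => (hj k h).not_ge hk
    rw [ne_eq, Fin.ext_iff] at hki hkj
    simp only [Set.mem_Icc]
    grind

theorem exists_forall_le_and_coe_lt_iff {ι α : Type*} [LinearOrder α] [NoMinOrder α] [Nonempty α]
    {s : Set ι} (hs : s.Finite) {f : ι → α} {b : WithTop α} :
    (∃ a, (∀ k ∈ s, f k ≤ a) ∧ (a : WithTop α) < b) ↔ ∀ k ∈ s, (f k : WithTop α) < b := by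
  constructor
  · rintro ⟨a, hle, hlt⟩ k hk
    exact (WithTop.coe_le_coe.2 (hle k hk)).trans_lt hlt
  · intro h
    rcases s.eq_empty_or_nonempty with rfl | hne
    · obtain ⟨a, ha⟩ : ∃ a : α, (a : WithTop α) < b := by
        induction b with
        | top => exact ⟨Classical.arbitrary α, WithTop.coe_lt_top _⟩
        | coe b => exact (exists_lt b).imp fun _ => WithTop.coe_lt_coe.2
      exact ⟨a, by simp, ha⟩
    · obtain ⟨k, hk, hmax⟩ := Set.exists_max_image s f hs hne
      exact ⟨f k, hmax, h k hk⟩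

theorem dualGraph_timeSeriesMergeTree (τ : Fin n → ℝ) :
    dualGraph (timeSeriesMergeTree τ) = horizonVisibilityGraph τ := by
  refine simpleGraph_ext_castSucc_succ fun i j hij => ?_
  rw [dualGraph_adj_iff (isPlaneTree_timeSeriesMergeTree τ).isIntervalFamily hij,
    mem_timeSeriesMergeTree_iff, horizonVisibilityGraph_adj_iff hij]
  simp only [isClusterAt_Icc_iff hij]
  exact exists_forall_le_and_coe_lt_iff (Set.toFinite _)

end Visibility

namespace MergePoint

section TopologicalSpace

variable {X : Type*} [TopologicalSpace X] {f : X → ℝ} {p q : MergePoint f} {x : X}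

theorem carrier_eq (hx : x ∈ p.carrier) :
    p.carrier = connectedComponentIn {y | f y ≤ p.level} x := by
  obtain ⟨y, -, hp⟩ := p.isComponent
  rw [hp] at hx ⊢
  exact connectedComponentIn_eq hx

theorem nonempty_carrier (p : MergePoint f) : p.carrier.Nonempty := by
  obtain ⟨y, hy, hp⟩ := p.isComponent
  exact ⟨y, hp ▸ mem_connectedComponentIn hy⟩

theorem apply_le_level (hx : x ∈ p.carrier) : f x ≤ p.level := by
  rw [carrier_eq hx] at hx
  have hx' : x ∈ {y | f y ≤ p.level} := connectedComponentIn_subset _ _ hx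
  exact hx'

theorem le_of_level_le (hxp : x ∈ p.carrier) (hxq : x ∈ q.carrier) (h : p.level ≤ q.level) :
    p ≤ q := by
  refine ⟨h, ?_⟩
  rw [carrier_eq hxp, carrier_eq hxq]
  exact connectedComponentIn_mono x fun y hy => le_trans hy h

theorem le_or_le_of_mem (hxp : x ∈ p.carrier) (hxq : x ∈ q.carrier) : p ≤ q ∨ q ≤ p :=
  (le_total p.level q.level).imp (le_of_level_le hxp hxq) (le_of_level_le hxq hxp)

theorem isForestOrder : IsForestOrder (MergePoint f) := fun p _ _ hpq hpr =>
  p.nonempty_carrier.elim fun _ hx => le_or_le_of_mem (hpq.2 hx) (hpr.2 hx)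

theorem disjoint_carrier_iff : Disjoint p.carrier q.carrier ↔ ¬ p ≤ q ∧ ¬ q ≤ p := by
  rw [← not_or, ← not_iff_not, not_not, Set.not_disjoint_iff]
  constructor
  · rintro ⟨x, hxp, hxq⟩
    exact le_or_le_of_mem hxp hxq
  · rintro (hpq | hqp)
    · exact p.nonempty_carrier.imp fun x hx => ⟨hx, hpq.2 hx⟩
    · exact q.nonempty_carrier.imp fun x hx => ⟨hqp.2 hx, hx⟩

/-- The canonical map from the domain of a function to its merge tree: `x` lies on the component
of its own sublevel set, at level `f x`. -/
def ofPoint (f : X → ℝ) (x : X) : MergePoint f :=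
  ⟨connectedComponentIn {y | f y ≤ f x} x, f x, x, le_rfl, rfl⟩

theorem mem_carrier_ofPoint (f : X → ℝ) (x : X) : x ∈ (ofPoint f x).carrier :=
  mem_connectedComponentIn (F := {y | f y ≤ f x}) (le_refl (f x))

theorem ofPoint_le_iff : ofPoint f x ≤ p ↔ x ∈ p.carrier :=
  ⟨fun h => h.2 (mem_carrier_ofPoint f x), fun hx =>
    le_of_level_le (mem_carrier_ofPoint f x) hx (apply_le_level hx)⟩

end TopologicalSpace

section LinearOrder

variable {X : Type*} [ConditionallyCompleteLinearOrder X] [TopologicalSpace X] [OrderTopology X]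
  {f : X → ℝ} {p : MergePoint f} {x : X}

theorem ordConnected_carrier (p : MergePoint f) : p.carrier.OrdConnected := by
  obtain ⟨x, -, hp⟩ := p.isComponent
  rw [hp]
  exact isPreconnected_connectedComponentIn.ordConnected

theorem carrier_eq_ordConnectedComponent [DenselyOrdered X] (hx : x ∈ p.carrier) :
    p.carrier = Set.ordConnectedComponent {y | f y ≤ p.level} x := by
  have := p.ordConnected_carrier
  refine Set.Subset.antisymm
    (Set.subset_ordConnectedComponent hx fun y hy => apply_le_level hy) fun y hy => ?_
  rw [carrier_eq hx]
  exact isPreconnected_uIcc.subset_connectedComponentIn Set.left_mem_uIcc hy Set.right_mem_uIcc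

end LinearOrder

end MergePoint

section Interpolation

/-- The function on `ℝ` that takes the value `c k` at every integer `k` and is affine in between.
With `c = clampedEntry τ` this is `plInterpolation τ`. -/
noncomputable def linearInterpolation (c : ℤ → ℝ) (t : ℝ) : ℝ :=
  (1 - Int.fract t) * c ⌊t⌋ + Int.fract t * c (⌊t⌋ + 1)

variable {c : ℤ → ℝ} {a t : ℝ} {m l : ℤ}

theorem linearInterpolation_intCast (c : ℤ → ℝ) (m : ℤ) : linearInterpolation c m = c m := by
  simp [linearInterpolation]

theorem linearInterpolation_eq_lineMap (hmt : (m : ℝ) ≤ t) (htm : t ≤ m + 1) :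
    linearInterpolation c t = AffineMap.lineMap (c m) (c (m + 1)) (t - m) := by
  rw [AffineMap.lineMap_apply_ring]
  rcases htm.eq_or_lt with rfl | hlt
  · have := linearInterpolation_intCast c (m + 1)
    push_cast at this
    simp [this]
  · have hfloor : ⌊t⌋ = m := Int.floor_eq_iff.2 ⟨hmt, hlt⟩
    simp [linearInterpolation, Int.fract, hfloor]

theorem linearInterpolation_le (hfloor : c ⌊t⌋ ≤ a) (hceil : c ⌈t⌉ ≤ a) :
    linearInterpolation c t ≤ a := by
  by_cases ht : t ∈ Set.range Int.cast
  · obtain ⟨m, rfl⟩ := ht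
    rwa [linearInterpolation_intCast, ← Int.floor_intCast (R := ℝ) m]
  · rw [(Int.ceil_eq_floor_add_one_iff_notMem t).2 ht] at hceil
    exact convex_Iic a hfloor hceil (sub_nonneg.2 (Int.fract_lt_one t).le) (Int.fract_nonneg t)
      (sub_add_cancel 1 _)

theorem uIcc_subset_sublevel_linearInterpolation_iff :
    Set.uIcc (m : ℝ) l ⊆ {t | linearInterpolation c t ≤ a} ↔ Set.uIcc m l ⊆ {i | c i ≤ a} := by
  constructor
  · intro h i hi
    have hi' : (i : ℝ) ∈ Set.uIcc (m : ℝ) l := Int.cast_mono.mapsTo_uIcc hi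
    simpa only [Set.mem_ofPred_eq, linearInterpolation_intCast] using h hi'
  · intro h t ht
    have hfloor := Int.floor_mono.mapsTo_uIcc ht
    have hceil := Int.ceil_mono.mapsTo_uIcc ht
    rw [Int.floor_intCast, Int.floor_intCast] at hfloor
    rw [Int.ceil_intCast, Int.ceil_intCast] at hceil
    exact linearInterpolation_le (h hfloor) (h hceil)

theorem exists_int_uIcc_subset_sublevel_linearInterpolation (c : ℤ → ℝ) (t : ℝ) :
    ∃ m : ℤ, Set.uIcc t m ⊆ {s | linearInterpolation c s ≤ linearInterpolation c t} := by
  have eq_lineMap {s : ℝ} := linearInterpolation_eq_lineMap (c := c) (t := s) (m := ⌊t⌋)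
  have hfloor := Int.floor_le t
  have hlt := (Int.lt_floor_add_one t).le
  rcases le_total (c ⌊t⌋) (c (⌊t⌋ + 1)) with hc | hc
  · refine ⟨⌊t⌋, fun s hs => ?_⟩
    rw [Set.uIcc_of_ge hfloor] at hs
    rw [Set.mem_ofPred_eq, eq_lineMap hs.1 (hs.2.trans hlt), eq_lineMap hfloor hlt]
    exact AffineMap.lineMap_mono hc (by linarith [hs.2])
  · refine ⟨⌊t⌋ + 1, fun s hs => ?_⟩
    push_cast at hs
    rw [Set.uIcc_of_le hlt] at hs
    rw [Set.mem_ofPred_eq, eq_lineMap (hfloor.trans hs.1) hs.2, eq_lineMap hfloor hlt]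
    rw [← AffineMap.lineMap_apply_one_sub (c (⌊t⌋ + 1)),
      ← AffineMap.lineMap_apply_one_sub (c (⌊t⌋ + 1))]
    exact AffineMap.lineMap_mono hc (by linarith [hs.1])

end Interpolation

section Samples

variable {n : ℕ} {τ : Fin n → ℝ} {a : ℝ} {k l : Fin n}

/-- The time at which the entry `τ k` is sampled, that is, the one-based index of this entry. -/
def sampleTime (k : Fin n) : ℤ :=
  k + 1

theorem sampleTime_lt_sampleTime : sampleTime k < sampleTime l ↔ k < l := by
  simp [sampleTime]

theorem sampleTime_mono : Monotone (sampleTime (n := n)) := fun k l hkl => by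
  simpa [sampleTime] using hkl

/-- The entries of a time series of length `n` sampled in the set `A` of times. -/
def samplesIn (n : ℕ) (A : Set ℝ) : Set (Fin n) :=
  {k | (sampleTime k : ℝ) ∈ A}

theorem samplesIn_mono {A B : Set ℝ} (h : A ⊆ B) : samplesIn n A ⊆ samplesIn n B :=
  fun _ hk => h hk

variable [NeZero n]

theorem clampedEntry_sampleTime (τ : Fin n → ℝ) (k : Fin n) :
    clampedEntry τ (sampleTime k) = τ k := by
  rw [clampedEntry]
  congr 1
  ext
  simp only [sampleTime]
  omega

theorem plInterpolation_sampleTime (τ : Fin n → ℝ) (k : Fin n) :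
    plInterpolation τ (sampleTime k) = τ k :=
  (linearInterpolation_intCast _ _).trans (clampedEntry_sampleTime τ k)

theorem uIcc_sampleTime_subset_sublevel_iff :
    Set.uIcc (sampleTime k : ℝ) (sampleTime l) ⊆ {t | plInterpolation τ t ≤ a} ↔
      Set.uIcc k l ⊆ {m | τ m ≤ a} := by
  refine uIcc_subset_sublevel_linearInterpolation_iff.trans ⟨fun h m hm => ?_, fun h i hi => ?_⟩
  · have hm' : clampedEntry τ (sampleTime m) ≤ a := h (sampleTime_mono.mapsTo_uIcc hm)
    rwa [clampedEntry_sampleTime] at hm'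
  · obtain ⟨m, rfl⟩ : ∃ m : Fin n, sampleTime m = i := by
      simp only [Set.mem_uIcc, sampleTime] at hi
      exact ⟨⟨(i - 1).toNat, by omega⟩, by simp only [sampleTime]; omega⟩
    rw [Set.mem_ofPred_eq, clampedEntry_sampleTime]
    refine h ?_
    simpa [Set.mem_uIcc, sampleTime] using hi

theorem exists_clampedEntry_eq_on_uIcc (τ : Fin n → ℝ) (i : ℤ) :
    ∃ k : Fin n, ∀ j ∈ Set.uIcc i (sampleTime k), clampedEntry τ j = clampedEntry τ i := by
  refine ⟨⟨min (i - 1).toNat (n - 1), by have := NeZero.pos n; omega⟩, fun j hj => ?_⟩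
  simp only [Set.mem_uIcc, sampleTime] at hj
  rw [clampedEntry, clampedEntry]
  congr 2
  omega

theorem exists_uIcc_sampleTime_subset_sublevel (τ : Fin n → ℝ) (t : ℝ) :
    ∃ k : Fin n, Set.uIcc t (sampleTime k) ⊆ {s | plInterpolation τ s ≤ plInterpolation τ t} := by
  obtain ⟨i, hi⟩ := exists_int_uIcc_subset_sublevel_linearInterpolation (clampedEntry τ) t
  obtain ⟨k, hk⟩ := exists_clampedEntry_eq_on_uIcc τ i
  have hit : clampedEntry τ i ≤ plInterpolation τ t := by
    have := hi Set.right_mem_uIcc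
    rwa [Set.mem_ofPred_eq, linearInterpolation_intCast] at this
  refine ⟨k, Set.uIcc_subset_uIcc_union_uIcc.trans (Set.union_subset hi ?_)⟩
  exact uIcc_subset_sublevel_linearInterpolation_iff.2 fun j hj => (hk j hj).trans_le hit

theorem nonempty_samplesIn (p : MergePoint (plInterpolation τ)) :
    (samplesIn n p.carrier).Nonempty := by
  obtain ⟨t, ht⟩ := p.nonempty_carrier
  obtain ⟨k, hk⟩ := exists_uIcc_sampleTime_subset_sublevel τ t
  refine ⟨k, ?_⟩
  rw [samplesIn, Set.mem_ofPred_eq, MergePoint.carrier_eq_ordConnectedComponent ht]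
  exact hk.trans fun s hs => le_trans hs (MergePoint.apply_le_level ht)

theorem samplesIn_eq_ordConnectedComponent {p : MergePoint (plInterpolation τ)}
    (hk : k ∈ samplesIn n p.carrier) :
    samplesIn n p.carrier = Set.ordConnectedComponent {l | τ l ≤ p.level} k := by
  ext l
  rw [samplesIn, Set.mem_ofPred_eq, MergePoint.carrier_eq_ordConnectedComponent hk,
    Set.mem_ordConnectedComponent, Set.mem_ordConnectedComponent,
    uIcc_sampleTime_subset_sublevel_iff]

theorem ordConnected_samplesIn (p : MergePoint (plInterpolation τ)) :
    (samplesIn n p.carrier).OrdConnected := by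
  obtain ⟨k, hk⟩ := nonempty_samplesIn p
  rw [samplesIn_eq_ordConnectedComponent hk]
  infer_instance

theorem isClusterAt_edgeEnds_samplesIn (p : MergePoint (plInterpolation τ)) :
    IsClusterAt τ p.level (edgeEnds (samplesIn n p.carrier)) := by
  obtain ⟨k, hk⟩ := nonempty_samplesIn p
  have hkp : τ k ≤ p.level := plInterpolation_sampleTime τ k ▸ MergePoint.apply_le_level hk
  rw [samplesIn_eq_ordConnectedComponent hk]
  exact isClusterAt_edgeEnds_ordConnectedComponent hkp

end Samples

namespace IsPlaneTree

variable {n : ℕ} {T : Set (Set (Fin (n + 1)))}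

theorem not_isMin_iff_nontrivial (hT : IsPlaneTree T) {C : T} :
    ¬ IsMin C ↔ (C : Set (Fin (n + 1))).Nontrivial := by
  rw [not_isMin_iff]
  constructor
  · rintro ⟨D, hDC⟩
    obtain ⟨x, hx⟩ := hT.nonempty D D.2
    obtain ⟨y, hyC, hyD⟩ := Set.exists_of_ssubset hDC
    exact ⟨x, hDC.le hx, y, hyC, ne_of_mem_of_not_mem hx hyD⟩
  · rintro ⟨x, hx, y, hy, hxy⟩
    refine ⟨⟨{x}, hT.leaf_mem x⟩, Set.ssubset_iff_exists.2 ?_⟩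
    exact ⟨Set.singleton_subset_iff.2 hx, y, hy, hxy.symm⟩

theorem disjoint_iff (hT : IsPlaneTree T) {C D : T} :
    Disjoint (C : Set (Fin (n + 1))) D ↔ ¬ C ≤ D ∧ ¬ D ≤ C := by
  constructor
  · intro h
    exact ⟨fun hCD => (hT.nonempty C C.2).ne_empty (h.eq_bot_of_le hCD),
      fun hDC => (hT.nonempty D D.2).ne_empty (h.symm.eq_bot_of_le hDC)⟩
  · rintro ⟨hCD, hDC⟩
    exact ((hT.laminar C C.2 D D.2).resolve_left hCD).resolve_left hDC

end IsPlaneTree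

theorem leftOf_iff_disjoint_and_lt {α : Type*} [LinearOrder α] {s t : Set α} {x y : α}
    (hs : s.OrdConnected) (ht : t.OrdConnected) (hx : x ∈ s) (hy : y ∈ t) :
    LeftOf s t ↔ Disjoint s t ∧ x < y := by
  constructor
  · exact fun h => ⟨Set.disjoint_left.2 fun z hs ht => (h z hs z ht).false, h x hx y hy⟩
  · rintro ⟨hdisj, hxy⟩ a ha b hb
    by_contra! hba
    rcases le_or_gt y a with hya | hay
    · exact Set.disjoint_left.1 hdisj (hs.out hx ha ⟨hxy.le, hya⟩) hy
    · exact Set.disjoint_left.1 hdisj ha (ht.out hb hy ⟨hba, hay.le⟩)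

section ClusterCoinsertion

variable {n : ℕ} {τ : Fin n → ℝ}

theorem nontrivial_coe_cutLeaves (C : CutLeaves (timeSeriesMergeTree τ)) :
    (C.1 : Set (Fin (n + 1))).Nontrivial :=
  (isPlaneTree_timeSeriesMergeTree τ).not_isMin_iff_nontrivial.1 C.2

theorem ordConnected_coe_cutLeaves (C : CutLeaves (timeSeriesMergeTree τ)) :
    (C.1 : Set (Fin (n + 1))).OrdConnected :=
  (isPlaneTree_timeSeriesMergeTree τ).ordConnected _ C.1.2

theorem exists_max_innerEdges (C : CutLeaves (timeSeriesMergeTree τ)) :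
    ∃ k ∈ innerEdges (C.1 : Set (Fin (n + 1))), ∀ l ∈ innerEdges (C.1 : Set (Fin (n + 1))),
      τ l ≤ τ k :=
  Set.exists_max_image _ τ (Set.toFinite _)
    (nonempty_innerEdges (ordConnected_coe_cutLeaves C) (nontrivial_coe_cutLeaves C))

/-- An inner edge of largest weight of a vertex of the merge tree that is not a leaf. Its weight
is the level at which the vertex appears. -/
noncomputable def peakEdge (C : CutLeaves (timeSeriesMergeTree τ)) : Fin n :=
  (exists_max_innerEdges C).choose

theorem peakEdge_mem_innerEdges (C : CutLeaves (timeSeriesMergeTree τ)) :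
    peakEdge C ∈ innerEdges (C.1 : Set (Fin (n + 1))) :=
  (exists_max_innerEdges C).choose_spec.1

theorem isClusterAt_peakEdge (C : CutLeaves (timeSeriesMergeTree τ)) :
    IsClusterAt τ (τ (peakEdge C)) C.1 := by
  obtain ⟨a, hC⟩ := mem_timeSeriesMergeTree_iff.1 C.1.2
  exact hC.of_le (hC.le_of_mem_innerEdges _ (peakEdge_mem_innerEdges C))
    (exists_max_innerEdges C).choose_spec.2

variable [NeZero n]

/-- The point at which the component of the sublevel sets of `plInterpolation τ` corresponding to
the vertex `C` appears. -/
noncomputable def clusterPoint (C : CutLeaves (timeSeriesMergeTree τ)) :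
    MergePoint (plInterpolation τ) :=
  MergePoint.ofPoint (plInterpolation τ) (sampleTime (peakEdge C))

theorem sampleTime_peakEdge_mem_carrier (C : CutLeaves (timeSeriesMergeTree τ)) :
    (sampleTime (peakEdge C) : ℝ) ∈ (clusterPoint C).carrier :=
  MergePoint.mem_carrier_ofPoint _ _

theorem samplesIn_clusterPoint (C : CutLeaves (timeSeriesMergeTree τ)) :
    samplesIn n (clusterPoint C).carrier = innerEdges (C.1 : Set (Fin (n + 1))) := by
  have hlevel : (clusterPoint C).level = τ (peakEdge C) := plInterpolation_sampleTime τ _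
  rw [samplesIn_eq_ordConnectedComponent (sampleTime_peakEdge_mem_carrier C), hlevel,
    (isClusterAt_peakEdge C).innerEdges_eq_ordConnectedComponent (peakEdge_mem_innerEdges C)]

/-- The vertex of the merge tree of `τ` whose inner edges are the entries sampled in `p`. -/
def pointCluster (p : MergePoint (plInterpolation τ)) : CutLeaves (timeSeriesMergeTree τ) :=
  ⟨⟨edgeEnds (samplesIn n p.carrier),
    mem_timeSeriesMergeTree_iff.2 ⟨_, isClusterAt_edgeEnds_samplesIn p⟩⟩,
    (isPlaneTree_timeSeriesMergeTree τ).not_isMin_iff_nontrivial.2 <| by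
      obtain ⟨k, hk⟩ := nonempty_samplesIn p
      exact ⟨_, Or.inl ⟨k, hk, rfl⟩, _, Or.inr ⟨k, hk, rfl⟩, Fin.castSucc_lt_succ.ne⟩⟩

theorem gc_clusterPoint_pointCluster :
    GaloisConnection (clusterPoint (τ := τ)) pointCluster := fun C p => by
  change _ ↔ (C.1 : Set (Fin (n + 1))) ⊆ edgeEnds (samplesIn n p.carrier)
  constructor
  · intro h
    rw [← edgeEnds_innerEdges (ordConnected_coe_cutLeaves C) (nontrivial_coe_cutLeaves C),
      ← samplesIn_clusterPoint]
    exact gc_edgeEnds_innerEdges.monotone_l (samplesIn_mono h.2)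
  · intro h
    refine MergePoint.ofPoint_le_iff.2 ?_
    change peakEdge C ∈ samplesIn n p.carrier
    rw [← innerEdges_edgeEnds (ordConnected_samplesIn p)]
    exact gc_edgeEnds_innerEdges.monotone_u h (peakEdge_mem_innerEdges C)

theorem pointCluster_clusterPoint (C : CutLeaves (timeSeriesMergeTree τ)) :
    pointCluster (clusterPoint C) = C := by
  refine Subtype.ext (Subtype.ext ?_)
  change edgeEnds (samplesIn n (clusterPoint C).carrier) = _
  rw [samplesIn_clusterPoint,
    edgeEnds_innerEdges (ordConnected_coe_cutLeaves C) (nontrivial_coe_cutLeaves C)]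

/-- Without its leaves, the merge tree of `τ` is a coreflective suborder of the merge tree of
`plInterpolation τ`. -/
noncomputable def clusterCoinsertion (τ : Fin n → ℝ) :
    GaloisCoinsertion (clusterPoint (τ := τ)) pointCluster :=
  gc_clusterPoint_pointCluster.toGaloisCoinsertion fun C => (pointCluster_clusterPoint C).le

theorem leftOf_clusterPoint_iff (C D : CutLeaves (timeSeriesMergeTree τ)) :
    LeftOf (C.1 : Set (Fin (n + 1))) D.1 ↔
      LeftOf (clusterPoint C).carrier (clusterPoint D).carrier := by
  rw [leftOf_iff_disjoint_and_lt (ordConnected_coe_cutLeaves C) (ordConnected_coe_cutLeaves D)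
      (peakEdge_mem_innerEdges C).1 (peakEdge_mem_innerEdges D).1,
    leftOf_iff_disjoint_and_lt (MergePoint.ordConnected_carrier _)
      (MergePoint.ordConnected_carrier _) (sampleTime_peakEdge_mem_carrier C)
      (sampleTime_peakEdge_mem_carrier D),
    (isPlaneTree_timeSeriesMergeTree τ).disjoint_iff, MergePoint.disjoint_carrier_iff,
    (clusterCoinsertion τ).l_le_l_iff, (clusterCoinsertion τ).l_le_l_iff, Int.cast_lt,
    sampleTime_lt_sampleTime, Fin.castSucc_lt_castSucc_iff, Subtype.coe_le_coe,
    Subtype.coe_le_coe]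

end ClusterCoinsertion

/-- The merge tree of a time series `τ` is the unique plane tree whose dual is the horizon
visibility graph of `τ`, and its first Horton pruning is isomorphic, as a plane rooted tree, to the
branch structure of the merge tree of the piecewise linear interpolation of `τ`. -/
theorem mainTheorem5 (n : ℕ) [NeZero n] (τ : Fin n → ℝ) :
    (∀ T : Set (Set (Fin (n + 1))),
      IsPlaneTree T ∧ dualGraph T = horizonVisibilityGraph τ ↔ T = timeSeriesMergeTree τ) ∧
    ∃ e : HortonPruning (timeSeriesMergeTree τ) ≃o MergeVertex (plInterpolation τ),
      ∀ u v : HortonPruning (timeSeriesMergeTree τ),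
        LeftOf (u.1.1 : Set (Fin (n + 1))) (v.1.1 : Set (Fin (n + 1))) ↔
          LeftOf (e u).1.carrier (e v).1.carrier := by
  refine ⟨fun T => ⟨?_, ?_⟩, ?_⟩
  · rintro ⟨hT, hdual⟩
    exact dualGraph_injOn hT.isIntervalFamily (isPlaneTree_timeSeriesMergeTree τ).isIntervalFamily
      (hdual.trans (dualGraph_timeSeriesMergeTree τ).symm)
  · rintro rfl
    exact ⟨isPlaneTree_timeSeriesMergeTree τ, dualGraph_timeSeriesMergeTree τ⟩
  · exact ⟨MergePoint.isForestOrder.contractChainsOrderIso (clusterCoinsertion τ),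
      fun u v => leftOf_clusterPoint_iff u.1 v.1⟩
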